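/- Let $d\ge 2$ and let $G<O(d)$ be a finite reflection group, i.e. a finite subgroup of $O(d)$ generated by orthogonal reflections across linear hyperplanes. Assume that $G$ is $d$-dimensional, i.e. that no nonzero vector of $\mathbb{R}^d$ is fixed by every element of $G$. Let $r=|G|$ (so $r\ge 4$) and $N=(r-2)(d+1)+2$. Then there is a dense open set $U\subseteq(\mathbb{R}^d)^N$ whose complement has Lebesgue measure zero such that, for every $(x_1,\dots,x_N)\in U$, the points $x_1,\dots,x_N$ are distinct and there exist $u\in\mathbb{R}^d\setminus\{0\}$ and $a\in\mathbb{R}^d$ such that: (i) $u$ has trivial stabilizer in $G$, i.e. the orbit polytope $P=\operatorname{Conv}\{a+g u : g\in G\}$ is a Coxeter permutahedron of $G$, and $P$ is $d$-dimensional; (ii) the isometry group of $P$ is $G$ acting about $a$: the isometries of $\mathbb{R}^d$ that map $P$ onto itself are exactly the maps $x\mapsto a+g(x-a)$ with $g\in G$; (iii) there are a partition $A_1,\dots,A_r$ of $\{x_1,\dots,x_N\}$ and $r$ distinct points $y_i\in\operatorname{Conv}(A_i)$, $1\le i\le r$, such that $\{y_1,\dots,y_r\}$ is the vertex set of $P$.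 -/

import Mathlib

open MeasureTheory

noncomputable section

namespace OrbitPartition

/-- `ℝ^d` with its Euclidean norm. -/
abbrev Euc (d : ℕ) : Type := EuclideanSpace ℝ (Fin d)

/-- The orthogonal group `O(d)`: linear isometries of `ℝ^d` onto itself, under composition. -/
abbrev Orth (d : ℕ) : Type := Euc d ≃ₗᵢ[ℝ] Euc d

variable {d : ℕ}

/-- `s` is the orthogonal reflection across a linear hyperplane `v^⊥`, `v ≠ 0`. -/
def IsHyperplaneReflection (s : Orth d) : Prop :=
  ∃ v : Euc d, v ≠ 0 ∧ s = (ℝ ∙ v)ᗮ.reflection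

/-- A finite reflection group: a finite subgroup of `O(d)` generated by the reflections
across linear hyperplanes that it contains. -/
def IsFiniteReflectionGroup (G : Subgroup (Orth d)) : Prop :=
  Finite G ∧ Subgroup.closure {s : Orth d | s ∈ G ∧ IsHyperplaneReflection s} = G

/-- `G` is genuinely `d`-dimensional: no nonzero vector of `ℝ^d` is fixed by all of `G`
(equivalently for a reflection group, `G` is a product of irreducible reflection groups whose
dimensions add up to `d`). -/
def IsEssential (G : Subgroup (Orth d)) : Prop :=
  ∀ v : Euc d, (∀ g ∈ G, g v = v) → v = 0

/-- The orbit polytope `P(G; u, a) = Conv(a + G · u)`. -/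
def orbitPolytope (G : Subgroup (Orth d)) (u a : Euc d) : Set (Euc d) :=
  convexHull ℝ {x : Euc d | ∃ g ∈ G, x = a + g u}

/-- The orbit polytope `P(G; u, a)` is free: `u` is nonzero and has trivial stabilizer in `G`. -/
def IsFreeOrbit (G : Subgroup (Orth d)) (u : Euc d) : Prop :=
  u ≠ 0 ∧ ∀ g ∈ G, g u = u → g = 1

/-- The isometry group of `P ⊆ ℝ^d`: all isometries of `ℝ^d` that map `P` onto itself. -/
def isometryGroup (P : Set (Euc d)) : Subgroup (Euc d ≃ᵢ Euc d) where
  carrier := {f | f '' P = P}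
  one_mem' := by
    show (fun x : Euc d => x) '' P = P
    simp
  mul_mem' := by
    intro f g hf hg
    show (fun x => f (g x)) '' P = P
    have hf' : f '' P = P := hf
    have hg' : g '' P = P := hg
    rw [← Set.image_image f g P, hg', hf']
  inv_mem' := by
    intro f hf
    have hf' : f '' P = P := hf
    show f.symm '' P = P
    conv_lhs => rw [← hf']
    rw [Set.image_image]
    simp

/-- The orthogonal action centred at the point `a`: the element `g` of `O(d)` acts on `ℝ^d` by
`x ↦ a + g (x - a)`. -/
def actionAbout (a : Euc d) : Orth d →* (Euc d ≃ᵢ Euc d) where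
  toFun g := ((IsometryEquiv.subRight a).trans g.toIsometryEquiv).trans (IsometryEquiv.addLeft a)
  map_one' := by
    ext1 x
    simp
  map_mul' g h := by
    ext1 x
    simp

theorem actionAbout_apply (a : Euc d) (g : Orth d) (x : Euc d) :
    actionAbout a g x = a + g (x - a) := rfl

/-- The set `S` can be `P`-partitioned, where `P` is a polytope on `r` vertices: there is a
partition `A_1, …, A_r` of `S` and there are `r` (distinct) points `y_i ∈ Conv(A_i)` that together
form the vertex set of `P`. -/
def CanBePartitionedBy (S : Set (Euc d)) (r : ℕ) (P : Set (Euc d)) : Prop :=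
  ∃ A : Fin r → Set (Euc d),
    Pairwise (fun i j => Disjoint (A i) (A j)) ∧ (⋃ i, A i) = S ∧
    ∃ y : Fin r → Euc d, Function.Injective y ∧ (∀ i, y i ∈ convexHull ℝ (A i)) ∧
      Set.range y = P.extremePoints ℝ

/-- A property holds for generic sets of `N` points in `ℝ^d`: there is a dense open set of full
Lebesgue measure in `(ℝ^d)^N` every element of which is a tuple of `N` distinct points
whose underlying set has the property. -/
def HoldsForGenericSets (d N : ℕ) (Q : Set (Euc d) → Prop) : Prop :=
  ∃ U : Set (Fin N → Euc d), IsOpen U ∧ Dense U ∧ volume Uᶜ = 0 ∧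
    ∀ x ∈ U, Function.Injective x ∧ Q (Set.range x)

end OrbitPartition

end

/-! Existence is Sarkaria's tensor trick. Put r = |G| and attach to the point xᵢ and the element g
the vector (xᵢ, 1) in the g-th slot of (ℝ^d × ℝ)^G, modulo the (2d+1)-dimensional space of families
g ↦ (a + g u, t). The quotient has dimension r(d+1) - 2d - 1 = N - 1, and for fixed i the r vectors
average to zero there. Colourful Carathéodory assigns to each xᵢ one g so that a convex combination
vanishes in the quotient: the blocks then have equal weight, and their weighted means form a
translated orbit a + G u (`exists_isOrbitCombination`).

The symmetry claims need u generic: whenever h is an involution or 1, no other g gives ⟪g u, u⟫ = ⟪h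
u, u⟫. An isometry of the polytope permutes its vertices, hence fixes their centroid a. Composed
with an element of G it also fixes u; inner products with u then force it to fix each s u, s a
reflection, and the vectors u - s u span (`IsGeneric.isometryGroup_orbitPolytope`).

Configurations admitting a non-generic u form a closed set (projection along a compact cube) that is
null: they lie in the image of a null set under a differentiable map between spaces of equal
dimension (`volume_degenerate_eq_zero`). -/

noncomputable section

namespace OrbitPartition

open scoped RealInnerProductSpace

/-! ### Colourful Carathéodory theorem. -/

section ColorfulCaratheodory

variable {V : Type*} [NormedAddCommGroup V] [InnerProductSpace ℝ V]

theorem norm_sq_le_inner_of_forall_norm_le {K : Set V} (hK : Convex ℝ K) {z : V} (hz : z ∈ K)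
    (hmin : ∀ w ∈ K, ‖z‖ ≤ ‖w‖) {w : V} (hw : w ∈ K) : ‖z‖ ^ 2 ≤ ⟪z, w⟫ := by
  have : Nonempty K := ⟨⟨z, hz⟩⟩
  have h : ‖(0 : V) - z‖ = ⨅ w : K, ‖(0 : V) - w‖ := by
    simp only [zero_sub, norm_neg]
    refine le_antisymm (le_ciInf fun w => hmin w w.2) ?_
    exact ciInf_le (f := fun w : K => ‖(w : V)‖)
      ⟨0, by rintro _ ⟨w, rfl⟩; exact norm_nonneg _⟩ ⟨z, hz⟩
  have h2 := (norm_eq_iInf_iff_real_inner_le_zero hK hz).1 h w hw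
  rw [zero_sub, inner_neg_left, inner_sub_right, real_inner_self_eq_norm_sq] at h2
  linarith

/-- If more than `dim V` points lie in the half-space `‖z‖² ≤ ⟪z, ·⟫` and `z ≠ 0` is in their
convex hull, then one of them can be omitted. -/
theorem exists_notMem_mem_convexHull_image [FiniteDimensional ℝ V] {ι : Type*} [Fintype ι]
    (hι : Module.finrank ℝ V < Fintype.card ι) (f : ι → V) {z : V} (hz0 : z ≠ 0)
    (hz : z ∈ convexHull ℝ (Set.range f)) (hle : ∀ i, ‖z‖ ^ 2 ≤ ⟪z, f i⟫) :
    ∃ i, z ∈ convexHull ℝ (f '' {i}ᶜ) := by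
  obtain ⟨κ, _, y, w, hy, hind, hw, hsum, hcomb⟩ := eq_pos_convex_span_of_mem_convexHull hz
  have hy' : ∀ k, ∃ i, f i = y k := fun k => hy ⟨k, rfl⟩
  choose φ hφ using hy'
  -- The points carrying positive weight lie on the supporting hyperplane at z, so at most dim V of
  -- them are affinely independent.
  have hinner : ∀ k, ⟪z, y k⟫ = ‖z‖ ^ 2 := by
    have h0 : ∑ k, w k * (⟪z, y k⟫ - ‖z‖ ^ 2) = 0 := by
      have : ⟪z, ∑ k, w k • y k⟫ = ‖z‖ ^ 2 := by rw [hcomb, real_inner_self_eq_norm_sq]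
      simp only [inner_sum, inner_smul_right] at this
      simp only [mul_sub, Finset.sum_sub_distrib, this, ← Finset.sum_mul, hsum, one_mul, sub_self]
    have hnn : ∀ k ∈ Finset.univ, 0 ≤ w k * (⟪z, y k⟫ - ‖z‖ ^ 2) := fun k _ =>
      mul_nonneg (hw k).le (sub_nonneg.2 (hφ k ▸ hle _))
    intro k
    have := (Finset.sum_eq_zero_iff_of_nonneg hnn).1 h0 k (Finset.mem_univ k)
    rcases mul_eq_zero.1 this with h | h
    · exact absurd h (hw k).ne'
    · linarith
  have hspan : vectorSpan ℝ (Set.range y) ≤ (ℝ ∙ z)ᗮ := by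
    rw [vectorSpan_def, Submodule.span_le]
    rintro _ ⟨_, ⟨k, rfl⟩, _, ⟨l, rfl⟩, rfl⟩
    rw [SetLike.mem_coe, Submodule.mem_orthogonal_singleton_iff_inner_right]
    simp only [vsub_eq_sub, inner_sub_right, hinner, sub_self]
  have hcard : Fintype.card κ < Fintype.card ι := by
    have h1 := hind.card_le_finrank_succ
    have h2 := Submodule.finrank_mono hspan
    have h3 := Submodule.finrank_add_finrank_orthogonal (ℝ ∙ z)
    rw [finrank_span_singleton hz0] at h3
    omega
  have : ¬ Function.Surjective φ := fun h => by
    have := Fintype.card_le_of_surjective φ h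
    omega
  simp only [Function.Surjective, not_forall, not_exists] at this
  obtain ⟨i, hi⟩ := this
  refine ⟨i, ?_⟩
  rw [← hcomb]
  refine (convex_convexHull ℝ _).sum_mem (fun k _ => (hw k).le) hsum fun k _ =>
    subset_convexHull ℝ _ ⟨φ k, hi k, hφ k⟩

/-- Bárány's argument: take a colourful hull nearest to 0, with nearest point z. If z ≠ 0, some
colour is not needed to express z; swapping its point for one with ⟪z, ·⟫ ≤ 0 keeps z in the hull,
so z is still nearest, contradicting the half-space inequality. -/
theorem colorful_caratheodory [FiniteDimensional ℝ V] {ι κ : Type*} [Fintype ι] [Finite κ]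
    (hι : Module.finrank ℝ V < Fintype.card ι) (p : ι → κ → V)
    (h : ∀ i, (0 : V) ∈ convexHull ℝ (Set.range (p i))) :
    ∃ c : ι → κ, (0 : V) ∈ convexHull ℝ (Set.range fun i => p i (c i)) := by
  classical
  have : Nonempty ι := Fintype.card_pos_iff.1 (by omega)
  have : Nonempty κ := by
    obtain ⟨i⟩ := ‹Nonempty ι›
    exact Set.range_nonempty_iff_nonempty.1 (convexHull_nonempty_iff.1 ⟨_, h i⟩)
  let K : (ι → κ) → Set V := fun c => convexHull ℝ (Set.range fun i => p i (c i))
  have hmin : ∀ c, ∃ z ∈ K c, ∀ w ∈ K c, ‖z‖ ≤ ‖w‖ := fun c =>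
    (Set.Finite.isCompact_convexHull ℝ (Set.finite_range _)).exists_isMinOn
      (convexHull_nonempty_iff.2 (Set.range_nonempty _)) continuous_norm.continuousOn
  choose z hzK hzmin using hmin
  obtain ⟨c, hc⟩ := Finite.exists_min fun c => ‖z c‖
  refine ⟨c, ?_⟩
  by_contra h0
  have hz0 : z c ≠ 0 := fun h => h0 (h ▸ hzK c)
  obtain ⟨i, hi⟩ := exists_notMem_mem_convexHull_image hι (fun i => p i (c i)) hz0 (hzK c)
    fun i => norm_sq_le_inner_of_forall_norm_le (convex_convexHull ℝ _) (hzK c) (hzmin c)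
      (subset_convexHull ℝ _ ⟨i, rfl⟩)
  obtain ⟨m, hm⟩ : ∃ m, ⟪z c, p i m⟫ ≤ 0 := by
    by_contra! hpos
    have : convexHull ℝ (Set.range (p i)) ⊆ {w | 0 < ⟪z c, w⟫} :=
      convexHull_min (by rintro _ ⟨m, rfl⟩; exact hpos m)
        (convex_halfSpace_gt (innerₛₗ ℝ (z c)).isLinear 0)
    simpa using this (h i)
  have hzK' : z c ∈ K (Function.update c i m) := by
    refine convexHull_mono ?_ hi
    rintro _ ⟨j, hj, rfl⟩
    exact ⟨j, by simp [Function.update_of_ne (show j ≠ i from hj)]⟩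
  have := norm_sq_le_inner_of_forall_norm_le (convex_convexHull ℝ _) hzK'
    (fun w hw => (hc _).trans (hzmin _ w hw))
    (subset_convexHull ℝ _ ⟨i, by simp⟩ : p i m ∈ K (Function.update c i m))
  have := norm_pos_iff.2 hz0
  nlinarith

end ColorfulCaratheodory

/-! ### Generic points for the quadratic forms of a finite group. -/

/-- The zero set of a nonzero quadratic form is a null set. -/
theorem ae_inner_map_self_ne_zero {E : Type*} [NormedAddCommGroup E] [InnerProductSpace ℝ E]
    [FiniteDimensional ℝ E] [MeasurableSpace E] [BorelSpace E] (μ : Measure E) [μ.IsAddHaarMeasure]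
    (T : E →L[ℝ] E) {v : E} (hv : ⟪T v, v⟫ ≠ 0) : ∀ᵐ u ∂μ, ⟪T u, u⟫ ≠ 0 := by
  have hmeas : MeasurableSet {u : E | ⟪T u, u⟫ ≠ 0} :=
    (isOpen_ne_fun (by fun_prop) continuous_const).measurableSet
  -- Fubini along lines parallel to v: there the form is a polynomial with leading coefficient ⟪T v,
  -- v⟫ ≠ 0.
  refine ae_mem_of_ae_add_linearMap_mem (LinearMap.toSpanSingleton ℝ E v) volume μ hmeas fun u => ?_
  let P : Polynomial ℝ := Polynomial.C ⟪T v, v⟫ * Polynomial.X ^ 2 +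
    Polynomial.C (⟪T u, v⟫ + ⟪T v, u⟫) * Polynomial.X + Polynomial.C ⟪T u, u⟫
  have hP : P ≠ 0 := fun h => hv <| by
    have := congrArg (fun p => Polynomial.coeff p 2) h
    simpa [P, Polynomial.coeff_X, Polynomial.coeff_C] using this
  rw [ae_iff]
  refine measure_mono_null (fun t ht => ?_) ((P.rootSet_finite ℝ).measure_zero volume)
  rw [Polynomial.mem_rootSet]
  refine ⟨hP, ?_⟩
  have h0 : ⟪T (u + t • v), u + t • v⟫ = 0 := not_not.1 ht
  simp only [map_add, map_smul, inner_add_left, inner_add_right, inner_smul_left,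
    inner_smul_right, RCLike.conj_to_real] at h0
  simp only [P, map_add, map_mul, map_pow, Polynomial.aeval_X, Polynomial.aeval_C,
    Algebra.algebraMap_self, RingHom.id_apply]
  linarith

variable {d : ℕ}

/-- The point `u` is separated by the quadratic forms `⟪g u, u⟫`: no involution of `G`
(or identity) takes the same value at `u` as another element of `G`. -/
def IsGeneric (G : Subgroup (Orth d)) (u : Euc d) : Prop :=
  ∀ g ∈ G, ∀ h ∈ G, h * h = 1 → g ≠ h → ⟪g u, u⟫ ≠ ⟪h u, u⟫

/-- Evaluating at u + h u gives ⟪g u, h u⟫ + ⟪g (h u), u⟫ = 2‖u‖², so Cauchy–Schwarz is an equality.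
Some restriction is needed: g and g⁻¹ always define the same form. -/
theorem eq_of_forall_inner_map_self_eq {g h : Orth d} (hh : h * h = 1)
    (H : ∀ u, ⟪g u, u⟫ = ⟪h u, u⟫) : g = h := by
  ext1 u
  have hhu : ∀ u, h (h u) = u := fun u => DFunLike.congr_fun hh u
  have h1 := H (u + h u)
  simp only [map_add, inner_add_left, inner_add_right, H, hhu] at h1
  have h2 : ⟪g (h u), u⟫ ≤ ‖u‖ ^ 2 := (real_inner_le_norm _ _).trans (by simp [sq])
  have h3 : ⟪g u, h u⟫ ≤ ‖u‖ ^ 2 := (real_inner_le_norm _ _).trans (by simp [sq])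
  have h4 : ⟪h u, h u⟫ = ‖u‖ ^ 2 := by simp
  have h5 : ⟪u, u⟫ = ‖u‖ ^ 2 := by simp
  have h6 : ‖g u - h u‖ ^ 2 = 0 := by
    have h7 : ‖g u - h u‖ ^ 2 = ‖u‖ ^ 2 - 2 * ⟪g u, h u⟫ + ‖u‖ ^ 2 := by
      rw [norm_sub_sq_real]; simp
    have := sq_nonneg ‖g u - h u‖
    linarith
  exact sub_eq_zero.1 (norm_eq_zero.1 (pow_eq_zero_iff two_ne_zero |>.1 h6))

theorem ae_isGeneric (G : Subgroup (Orth d)) [Finite G] : ∀ᵐ u : Euc d, IsGeneric G u := by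
  have key : ∀ g h : G, h.1 * h.1 = 1 → g ≠ h → ∀ᵐ u : Euc d, ⟪g.1 u, u⟫ ≠ ⟪h.1 u, u⟫ := by
    intro g h hh hgh
    obtain ⟨v, hv⟩ : ∃ v, ⟪g.1 v, v⟫ ≠ ⟪h.1 v, v⟫ := by
      by_contra! H
      exact hgh (Subtype.ext (eq_of_forall_inner_map_self_eq hh H))
    have := ae_inner_map_self_ne_zero (volume : Measure (Euc d))
      ((g.1.toContinuousLinearEquiv : Euc d →L[ℝ] Euc d) -
        (h.1.toContinuousLinearEquiv : Euc d →L[ℝ] Euc d)) (v := v)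
      (by simpa [inner_sub_left, sub_eq_zero] using hv)
    filter_upwards [this] with u hu
    simpa [inner_sub_left, sub_eq_zero] using hu
  have : ∀ᵐ u : Euc d, ∀ g h : G, h.1 * h.1 = 1 → g ≠ h → ⟪g.1 u, u⟫ ≠ ⟪h.1 u, u⟫ := by
    simp only [Filter.eventually_all]
    exact key
  filter_upwards [this] with u hu g hg h hh hinv hne
  exact hu ⟨g, hg⟩ ⟨h, hh⟩ hinv fun h => hne (congrArg Subtype.val h)

theorem isOpen_setOf_isGeneric (G : Subgroup (Orth d)) [Finite G] :
    IsOpen {u : Euc d | IsGeneric G u} := by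
  have : {u : Euc d | IsGeneric G u} =
      ⋂ g : G, ⋂ h : G, {u | h.1 * h.1 = 1 → g ≠ h → ⟪g.1 u, u⟫ ≠ ⟪h.1 u, u⟫} := by
    ext u
    simp only [IsGeneric, Set.mem_iInter]
    exact ⟨fun H g h h1 h2 => H g g.2 h h.2 h1 fun h => h2 (Subtype.ext h),
      fun H g hg h hh h1 h2 => H ⟨g, hg⟩ ⟨h, hh⟩ h1 fun h => h2 (congrArg Subtype.val h)⟩
  rw [this]
  refine isOpen_iInter_of_finite fun g => isOpen_iInter_of_finite fun h => ?_
  by_cases h1 : h.1 * h.1 = 1 <;> by_cases h2 : g = h <;>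
    simp only [h1, h2, ne_eq, not_true_eq_false, not_false_eq_true, forall_true_left,
      false_imp_iff, Set.ofPred_true, isOpen_univ]
  exact isOpen_ne_fun (by fun_prop) (by fun_prop)

/-! ### Reflections and the symmetries of generic orbit polytopes. -/

theorem IsHyperplaneReflection.mul_self {s : Orth d} (hs : IsHyperplaneReflection s) :
    s * s = 1 := by
  obtain ⟨v, -, rfl⟩ := hs
  exact Submodule.reflection_mul_reflection _

theorem IsHyperplaneReflection.apply_eq_self_of_inner_eq_zero {s : Orth d}
    (hs : IsHyperplaneReflection s) {u w : Euc d} (hu : s u ≠ u) (hw : ⟪w, u - s u⟫ = 0) :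
    s w = w := by
  obtain ⟨v, -, rfl⟩ := hs
  have h1 : ∀ x, (ℝ ∙ v)ᗮ.reflection x = x - (2 * (⟪v, x⟫ / ‖v‖ ^ 2)) • v := by
    intro x
    rw [Submodule.reflection_orthogonal_apply, Submodule.reflection_singleton_apply]
    simp only [RCLike.ofReal_real_eq_id, id_eq]
    module
  rw [h1] at hu hw
  rw [h1]
  have hc : 2 * (⟪v, u⟫ / ‖v‖ ^ 2) ≠ 0 := fun h => hu (by rw [h]; simp)
  rw [sub_sub_cancel, inner_smul_right, mul_eq_zero, real_inner_comm v w] at hw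
  rw [hw.resolve_left hc]
  simp

theorem IsHyperplaneReflection.ne_one {s : Orth d} (hs : IsHyperplaneReflection s) : s ≠ 1 := by
  obtain ⟨v, hv, rfl⟩ := hs
  intro h
  have h1 : (ℝ ∙ v)ᗮ.reflection v = v := DFunLike.congr_fun h v
  rw [Submodule.reflection_orthogonalComplement_singleton_eq_neg] at h1
  have h2 : (2 : ℝ) • v = 0 := by
    rw [two_smul]
    nth_rewrite 1 [← h1]
    simp
  exact hv ((smul_eq_zero.1 h2).resolve_left two_ne_zero)

section ReflectionGroup

variable {G : Subgroup (Orth d)}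

theorem IsGeneric.apply_ne {u : Euc d} (hu : IsGeneric G u) {g : Orth d} (hg : g ∈ G)
    (hg1 : g ≠ 1) : g u ≠ u := fun h =>
  hu g hg 1 G.one_mem (one_mul 1) hg1 (by rw [h]; rfl)

/-- Each u - s u is a nonzero normal to the mirror of s. A vector orthogonal to K is thus fixed by
all reflections, hence by G, hence zero. -/
theorem IsFiniteReflectionGroup.eq_top_of_forall_sub_mem (hG : IsFiniteReflectionGroup G)
    (hess : IsEssential G) {u : Euc d} (hu : IsGeneric G u) {K : Submodule ℝ (Euc d)}
    (hK : ∀ s ∈ G, IsHyperplaneReflection s → u - s u ∈ K) : K = ⊤ := by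
  rw [← Submodule.orthogonal_eq_bot_iff, Submodule.eq_bot_iff]
  intro w hw
  refine hess w fun g hg => ?_
  rw [← hG.2] at hg
  induction hg using Subgroup.closure_induction with
  | mem s hs =>
    exact hs.2.apply_eq_self_of_inner_eq_zero (hu.apply_ne hs.1 hs.2.ne_one)
      (Submodule.inner_left_of_mem_orthogonal (hK s hs.1 hs.2) hw)
  | one => rfl
  | mul g h _ _ hg hh => exact (congrArg g hh).trans hg
  | inv g _ hg => exact (LinearIsometryEquiv.symm_apply_eq g).2 hg.symm

theorem IsEssential.exists_ne_one (hess : IsEssential G) (hd : 0 < d) : ∃ g ∈ G, g ≠ 1 := by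
  by_contra! H
  have : Nonempty (Fin d) := ⟨⟨0, hd⟩⟩
  obtain ⟨v, hv⟩ := exists_ne (0 : Euc d)
  exact hv (hess v fun g hg => by rw [H g hg]; rfl)

theorem IsGeneric.isFreeOrbit (hess : IsEssential G) (hd : 0 < d) {u : Euc d}
    (hu : IsGeneric G u) : IsFreeOrbit G u := by
  refine ⟨?_, fun g hg h => by_contra fun hg1 => hu.apply_ne hg hg1 h⟩
  rintro rfl
  obtain ⟨g, hg, hg1⟩ := hess.exists_ne_one hd
  exact hu.apply_ne hg hg1 (map_zero g)

theorem IsGeneric.affineSpan_orbitPolytope (hG : IsFiniteReflectionGroup G)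
    (hess : IsEssential G) {u : Euc d} (hu : IsGeneric G u) (a : Euc d) :
    affineSpan ℝ (orbitPolytope G u a) = ⊤ := by
  have hmem : ∀ g ∈ G, a + g u ∈ affineSpan ℝ (orbitPolytope G u a) := fun g hg =>
    subset_affineSpan ℝ _ (subset_convexHull ℝ _ ⟨g, hg, rfl⟩)
  rw [← AffineSubspace.direction_eq_top_iff_of_nonempty ⟨_, hmem 1 G.one_mem⟩]
  refine hG.eq_top_of_forall_sub_mem hess hu fun s hs _ => ?_
  have := AffineSubspace.vsub_mem_direction (hmem 1 G.one_mem) (hmem s hs)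
  simpa using this

/-- The orbit lies on a sphere about a, and a Euclidean ball is strictly convex. -/
theorem extremePoints_orbitPolytope {u : Euc d} (hu : u ≠ 0) (a : Euc d) :
    (orbitPolytope G u a).extremePoints ℝ = {x | ∃ g ∈ G, x = a + g u} := by
  refine Set.Subset.antisymm extremePoints_convexHull_subset ?_
  have hsub : orbitPolytope G u a ⊆ Metric.closedBall a ‖u‖ := by
    refine convexHull_min ?_ (convex_closedBall _ _)
    rintro _ ⟨g, _, rfl⟩
    simp
  rintro _ ⟨g, hg, rfl⟩
  refine inter_extremePoints_subset_extremePoints_of_subset hsub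
    ⟨subset_convexHull ℝ _ ⟨g, hg, rfl⟩, ?_⟩
  exact StrictConvexSpace.sphere_subset_extremePoints_closedBall a (norm_ne_zero_iff.2 hu)
    (by simp)

theorem IsEssential.sum_apply_eq_zero [Fintype G] (hess : IsEssential G) (u : Euc d) :
    ∑ g : G, g.1 u = 0 := by
  refine hess _ fun h hh => ?_
  rw [map_sum]
  exact Equiv.sum_comp (Equiv.mulLeft (⟨h, hh⟩ : G)) fun g : G => g.1 u

theorem map_actionAbout_le_isometryGroup (u a : Euc d) :
    G.map (actionAbout a) ≤ isometryGroup (orbitPolytope G u a) := by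
  rintro _ ⟨g, hg, rfl⟩
  show actionAbout a g '' orbitPolytope G u a = orbitPolytope G u a
  have h1 : (actionAbout a g : Euc d → Euc d) =
      (actionAbout a g).toRealAffineIsometryEquiv.toAffineEquiv.toAffineMap := by
    ext1 x
    simp
  rw [orbitPolytope, h1, AffineMap.image_convexHull, ← h1]
  congr 1
  ext x
  constructor
  · rintro ⟨_, ⟨h, hh, rfl⟩, rfl⟩
    exact ⟨g * h, G.mul_mem hg hh, by simp [actionAbout_apply]⟩
  · rintro ⟨h, hh, rfl⟩
    exact ⟨a + (g⁻¹ * h) u, ⟨g⁻¹ * h, G.mul_mem (G.inv_mem hg) hh, rfl⟩,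
      by
        rw [actionAbout_apply, add_sub_cancel_left]
        exact congrArg (a + ·) (LinearIsometryEquiv.apply_symm_apply g (h u))⟩

/-- A linear isometry that permutes a generic orbit of a reflection group belongs to the group. -/
theorem IsGeneric.mem_of_forall_apply (hG : IsFiniteReflectionGroup G) (hess : IsEssential G)
    {u : Euc d} (hu : IsGeneric G u) {φ : Orth d}
    (hφ : ∀ g ∈ G, ∃ h ∈ G, φ (g u) = h u) : φ ∈ G := by
  obtain ⟨k, hk, hku⟩ := hφ 1 G.one_mem
  have hfix : (k⁻¹ * φ) u = u := (LinearIsometryEquiv.symm_apply_eq k).2 hku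
  have hrefl : ∀ s ∈ G, IsHyperplaneReflection s → (k⁻¹ * φ) (s u) = s u := by
    intro s hs hsr
    obtain ⟨h, hh, hhu⟩ := hφ s hs
    have h1 : (k⁻¹ * φ) (s u) = (k⁻¹ * h) u := congrArg (k⁻¹ : Orth d) hhu
    -- `k⁻¹ * φ` is an isometry fixing u. As s is an involution, genericity turns this equality into
    -- `k⁻¹ * h = s`.
    have h2 : ⟪(k⁻¹ * h) u, u⟫ = ⟪s u, u⟫ := by
      have := LinearIsometryEquiv.inner_map_map (k⁻¹ * φ) (s u) u
      rwa [hfix, h1] at this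
    have h3 : k⁻¹ * h = s := by_contra fun hne =>
      hu _ (G.mul_mem (G.inv_mem hk) hh) s hs hsr.mul_self hne h2
    rw [h1, h3]
  have htop := hG.eq_top_of_forall_sub_mem hess hu
    (K := LinearMap.eqLocus ((k⁻¹ * φ).toLinearEquiv : Euc d →ₗ[ℝ] Euc d) LinearMap.id)
    (fun s hs hsr => by
      show (k⁻¹ * φ) (u - s u) = u - s u
      rw [map_sub, hfix, hrefl s hs hsr])
  have h1 : k⁻¹ * φ = 1 := by
    ext1 x
    have : x ∈ (⊤ : Submodule ℝ (Euc d)) := trivial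
    rw [← htop] at this
    exact this
  rw [inv_mul_eq_one.1 h1] at hk
  exact hk

theorem mem_extremePoints_of_image_eq {E : Type*} [AddCommGroup E] [Module ℝ E]
    (F : E ≃ᵃ[ℝ] E) {P : Set E} (hF : F '' P = P) {x : E} (hx : x ∈ P.extremePoints ℝ) :
    F x ∈ P.extremePoints ℝ := by
  refine ⟨hF ▸ Set.mem_image_of_mem F hx.1, ?_⟩
  rw [← hF]
  rintro _ ⟨y, hy, rfl⟩ _ ⟨z, hz, rfl⟩ h
  have h1 := image_openSegment ℝ (F : E →ᵃ[ℝ] E) y z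
  simp only [AffineEquiv.coe_toAffineMap] at h1
  rw [← h1] at h
  obtain ⟨w, hw, hwx⟩ := h
  rw [hx.2 hy hz (F.injective hwx ▸ hw)]

theorem IsGeneric.isometryGroup_orbitPolytope (hG : IsFiniteReflectionGroup G)
    (hess : IsEssential G) (hd : 0 < d) {u : Euc d} (hu : IsGeneric G u) (a : Euc d) :
    isometryGroup (orbitPolytope G u a) = G.map (actionAbout a) := by
  refine le_antisymm ?_ (map_actionAbout_le_isometryGroup u a)
  intro f hf
  have hf' : f '' orbitPolytope G u a = orbitPolytope G u a := hf
  have := hG.1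
  have : Fintype G := Fintype.ofFinite G
  have hfree := hu.isFreeOrbit hess hd
  set F := f.toRealAffineIsometryEquiv with hF
  have hFf : ∀ x, f x = F x := fun x => by simp [hF]
  have hFlin : ∀ x y, F (x + y) = F x + F.linearIsometryEquiv y := fun x y => by
    simpa [add_comm] using F.map_vadd x y
  have hvert : ∀ g ∈ G, ∃ h ∈ G, f (a + g u) = a + h u := by
    intro g hg
    have h1 : a + g u ∈ (orbitPolytope G u a).extremePoints ℝ := by
      rw [extremePoints_orbitPolytope hfree.1]
      exact ⟨g, hg, rfl⟩
    have h2 : f (a + g u) ∈ (orbitPolytope G u a).extremePoints ℝ := by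
      refine mem_extremePoints_of_image_eq F.toAffineEquiv (P := orbitPolytope G u a) ?_ h1
      simpa [hF] using hf'
    rw [extremePoints_orbitPolytope hfree.1] at h2
    exact h2
  choose! σ hσG hσ using hvert
  have hσinj : Function.Injective fun g : G => (⟨σ g, hσG g g.2⟩ : G) := by
    intro g h hgh
    have h1 : σ g = σ h := congrArg Subtype.val hgh
    have h2 : a + g.1 u = a + h.1 u := f.injective (by rw [hσ g g.2, hσ h h.2, h1])
    have h3 : (h.1⁻¹ * g.1) u = u := (LinearIsometryEquiv.symm_apply_eq h.1).2 (add_left_cancel h2)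
    have h4 := hfree.2 _ (G.mul_mem (G.inv_mem h.2) g.2) h3
    exact Subtype.ext (inv_mul_eq_one.1 h4).symm
  have hσbij := Finite.injective_iff_bijective.1 hσinj
  -- The vertices are permuted and their mean is a, because the orbit sum is G-invariant and so
  -- zero.
  have hfa : f a = a := by
    have h1 : ∑ g : G, f (a + g.1 u) = ∑ g : G, (a + g.1 u) := by
      simp only [fun g : G => hσ g g.2]
      exact (Equiv.ofBijective _ hσbij).sum_comp fun g : G => a + g.1 u
    simp only [hFf, hFlin, Finset.sum_add_distrib, ← map_sum, hess.sum_apply_eq_zero, map_zero,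
      add_zero, Finset.sum_const] at h1
    rw [hFf]
    rw [← Nat.cast_smul_eq_nsmul ℝ, ← Nat.cast_smul_eq_nsmul ℝ] at h1
    exact smul_right_injective _
      (Nat.cast_ne_zero.2 (Finset.card_ne_zero.2 Finset.univ_nonempty)) h1
  refine ⟨F.linearIsometryEquiv, hu.mem_of_forall_apply hG hess fun g hg => ⟨σ g, hσG g hg, ?_⟩, ?_⟩
  · have := hσ g hg
    rw [hFf, hFlin, ← hFf, hfa] at this
    exact add_left_cancel this
  · ext1 x
    rw [actionAbout_apply]
    conv_rhs => rw [← add_sub_cancel a x, hFf, hFlin, ← hFf, hfa]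

end ReflectionGroup

/-! ### Sarkaria's tensor argument. -/

theorem exists_weights_of_mem_convexHull_range {ι V : Type*} [Fintype ι] [AddCommGroup V]
    [Module ℝ V] {v : ι → V} {z : V} (h : z ∈ convexHull ℝ (Set.range v)) :
    ∃ w : ι → ℝ, (∀ i, 0 ≤ w i) ∧ ∑ i, w i = 1 ∧ ∑ i, w i • v i = z := by
  classical
  rw [convexHull_range_eq_exists_affineCombination] at h
  obtain ⟨s, w, hw, hsum, rfl⟩ := h
  refine ⟨fun i => if i ∈ s then w i else 0, fun i => ?_, ?_, ?_⟩
  · dsimp only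
    split_ifs with hi
    exacts [hw i hi, le_rfl]
  · simpa using hsum
  · rw [Finset.affineCombination_eq_linear_combination _ _ _ hsum]
    simp [ite_smul]

open scoped Classical in
/-- The weights `lam` on the blocks `c⁻¹(g)` express the orbit points `a + g u` as affine
combinations of the points `x i`. -/
def IsOrbitCombination {G : Subgroup (Orth d)} {N : ℕ} (x : Fin N → Euc d) (c : Fin N → G)
    (lam : Fin N → ℝ) (u a : Euc d) : Prop :=
  ∀ g : G, ∑ i with c i = g, lam i = 1 ∧ ∑ i with c i = g, lam i • x i = a + g.1 u

/-- The linear map `(a, u, t) ↦ (g ↦ (a + g u, t))`. -/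
def orbitMap (G : Subgroup (Orth d)) : Euc d × Euc d × ℝ →ₗ[ℝ] G → Euc d × ℝ where
  toFun p g := (p.1 + g.1 p.2.1, p.2.2)
  map_add' p q := by
    ext1 g
    refine Prod.ext ?_ rfl
    simp only [Prod.fst_add, Prod.snd_add, map_add, Pi.add_apply]
    abel
  map_smul' t p := by
    ext1 g
    refine Prod.ext ?_ rfl
    simp

theorem orbitMap_injective {G : Subgroup (Orth d)} [Fintype G] (hess : IsEssential G) :
    Function.Injective (orbitMap G) := by
  rw [← LinearMap.ker_eq_bot, LinearMap.ker_eq_bot']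
  rintro ⟨a, u, t⟩ h
  have h1 : ∀ g : G, a + g.1 u = 0 := fun g => congrArg Prod.fst (congrFun h g)
  have ht : t = 0 := congrArg Prod.snd (congrFun h 1)
  have h2 : ∑ g : G, (a + g.1 u) = 0 := Finset.sum_eq_zero fun g _ => h1 g
  rw [Finset.sum_add_distrib, hess.sum_apply_eq_zero, add_zero, Finset.sum_const,
    ← Nat.cast_smul_eq_nsmul ℝ, smul_eq_zero] at h2
  have ha : a = 0 := h2.resolve_left
    (Nat.cast_ne_zero.2 (Finset.card_ne_zero.2 Finset.univ_nonempty))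
  have hu := h1 1
  rw [ha, zero_add] at hu
  exact Prod.ext ha (Prod.ext hu ht)

/-- Sarkaria's tensor argument: any `N` points can be split into `|G|` blocks whose convex hulls
meet the corresponding points of some translated orbit of `G`. -/
theorem exists_isOrbitCombination {G : Subgroup (Orth d)} [Fintype G] (hess : IsEssential G)
    {N : ℕ} (hN : Fintype.card G * (d + 1) < N + (2 * d + 1)) (x : Fin N → Euc d) :
    ∃ (c : Fin N → G) (lam : Fin N → ℝ) (u a : Euc d),
      (∀ i, 0 ≤ lam i) ∧ IsOrbitCombination x c lam u a := by
  classical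
  let Q := (G → Euc d × ℝ) ⧸ (orbitMap G).range
  have hQ : Module.finrank ℝ Q < Fintype.card (Fin N) := by
    have h1 := (orbitMap G).range.finrank_quotient_add_finrank
    rw [LinearMap.finrank_range_of_inj (orbitMap_injective hess)] at h1
    simp only [Module.finrank_prod, finrank_euclideanSpace, Fintype.card_fin,
      Module.finrank_self, Module.finrank_pi_fintype, Finset.sum_const, Finset.card_univ,
      smul_eq_mul] at h1
    change Module.finrank ℝ Q + _ = _ at h1
    rw [Fintype.card_fin]
    omega
  let e : Q ≃ₗ[ℝ] EuclideanSpace ℝ (Fin (Module.finrank ℝ Q)) :=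
    LinearEquiv.ofFinrankEq _ _ (by simp)
  let L : (G → Euc d × ℝ) →ₗ[ℝ] EuclideanSpace ℝ (Fin (Module.finrank ℝ Q)) :=
    e.toLinearMap ∘ₗ (orbitMap G).range.mkQ
  have hL : ∀ f, L f = 0 ↔ f ∈ (orbitMap G).range := fun f =>
    e.map_eq_zero_iff.trans (Submodule.Quotient.mk_eq_zero _)
  have hcardpos : (0 : ℝ) < Fintype.card G := Nat.cast_pos.2 Fintype.card_pos
  obtain ⟨c, hc⟩ := colorful_caratheodory (by simpa using hQ)
    (fun (i : Fin N) (g : G) => L (Pi.single g (x i, 1))) (fun i => by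
      -- The barycentre of the i-th colour class is killed: its sum is the image of (xᵢ, 0, 1) under
      -- `orbitMap`.
      refine mem_convexHull_of_exists_fintype (fun _ : G => (Fintype.card G : ℝ)⁻¹) _
        (fun _ => by positivity) (by simp [hcardpos.ne']) (fun g => ⟨g, rfl⟩) ?_
      rw [← Finset.smul_sum, ← map_sum, (hL _).2, smul_zero]
      refine ⟨(x i, 0, 1), ?_⟩
      ext1 g
      simp [orbitMap, Finset.sum_apply, Pi.single_apply])
  obtain ⟨w, hw, hsum, hw0⟩ := exists_weights_of_mem_convexHull_range hc
  simp only [← map_smul, ← map_sum] at hw0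
  obtain ⟨⟨a, u, t⟩, hp⟩ := (hL _).1 hw0
  have hg : ∀ g : G, ∑ i with c i = g, w i = t ∧ ∑ i with c i = g, w i • x i = a + g.1 u := by
    intro g
    have h1 := congrFun hp g
    simp only [orbitMap, LinearMap.coe_mk, AddHom.coe_mk, Finset.sum_apply, Pi.smul_apply,
      Pi.single_apply, smul_ite, smul_zero, Prod.smul_mk, smul_eq_mul, mul_one] at h1
    rw [← Finset.sum_filter] at h1
    have h2 : ∀ i, g = c i ↔ c i = g := fun i => eq_comm
    simp only [h2] at h1
    have h3 := congrArg Prod.fst h1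
    have h4 := congrArg Prod.snd h1
    simp only [Prod.fst_sum, Prod.snd_sum] at h3 h4
    exact ⟨h4.symm, h3.symm⟩
  have ht : Fintype.card G * t = 1 := by
    rw [← hsum, ← Finset.sum_fiberwise Finset.univ c w]
    simp [fun g => (hg g).1]
  -- Every block has weight t = 1/|G|; rescaling by |G| makes it 1.
  refine ⟨c, fun i => Fintype.card G * w i, (Fintype.card G : ℝ) • u, (Fintype.card G : ℝ) • a,
    fun i => mul_nonneg hcardpos.le (hw i), fun g => ⟨?_, ?_⟩⟩
  · rw [← Finset.mul_sum, (hg g).1, ht]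
  · simp only [mul_smul]
    rw [← Finset.smul_sum, (hg g).2, smul_add, map_smul]

/-! ### Degenerate configurations are closed and null. -/

section Generic

variable {G : Subgroup (Orth d)} {N : ℕ}

theorem IsOrbitCombination.le_one {x : Fin N → Euc d} {c : Fin N → G} {lam : Fin N → ℝ}
    {u a : Euc d} (h : IsOrbitCombination x c lam u a) (h0 : ∀ i, 0 ≤ lam i) (i : Fin N) :
    lam i ≤ 1 := by
  classical
  rw [← (h (c i)).1]
  exact Finset.single_le_sum (f := lam) (fun j _ => h0 j) (by simp)

/-- The configurations with labelling `c` for which some convex orbit combination has a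
non-generic `u`. -/
def degenerateSet (c : Fin N → G) : Set (Fin N → Euc d) :=
  {x | ∃ (lam : Fin N → ℝ) (u a : Euc d), (∀ i, 0 ≤ lam i) ∧
    IsOrbitCombination x c lam u a ∧ ¬ IsGeneric G u}

open scoped Classical in
theorem isClosed_degenerateSet [Fintype G] (hess : IsEssential G) (c : Fin N → G) :
    IsClosed (degenerateSet c) := by
  let y : (Fin N → Euc d) × Set.Icc (0 : Fin N → ℝ) 1 → G → Euc d := fun p g =>
    ∑ i with c i = g, p.2.1 i • p.1 i
  -- The centre is the mean of the block points and u is the point for g = 1 minus it, so both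
  -- depend continuously on (x, lam).
  let a : (Fin N → Euc d) × Set.Icc (0 : Fin N → ℝ) 1 → Euc d := fun p =>
    (Fintype.card G : ℝ)⁻¹ • ∑ g, y p g
  have hy : ∀ g, Continuous fun p => y p g := fun g => by
    exact continuous_finsetSum _ fun i _ =>
      ((continuous_apply i).comp (continuous_subtype_val.comp continuous_snd)).smul
        ((continuous_apply i).comp continuous_fst)
  have ha : Continuous a := Continuous.const_smul (g := fun p => ∑ g, y p g)
    (continuous_finsetSum _ fun g _ => hy g) (Fintype.card G : ℝ)⁻¹
  let Z : Set ((Fin N → Euc d) × Set.Icc (0 : Fin N → ℝ) 1) :=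
    {p | (∀ g, ∑ i with c i = g, p.2.1 i = 1) ∧ (∀ g, y p g = a p + g.1 (y p 1 - a p)) ∧
      y p 1 - a p ∈ {u | IsGeneric G u}ᶜ}
  have hZ : IsClosed Z := by
    have h1 : IsClosed (⋂ g, {p : (Fin N → Euc d) × Set.Icc (0 : Fin N → ℝ) 1 |
        ∑ i with c i = g, p.2.1 i = 1}) :=
      isClosed_iInter fun g => isClosed_eq (by fun_prop) continuous_const
    have h2 : IsClosed (⋂ g, {p | y p g = a p + g.1 (y p 1 - a p)}) :=
      isClosed_iInter fun g => isClosed_eq (hy g)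
        (ha.add (g.1.continuous.comp ((hy 1).sub ha)))
    have h3 := (isOpen_setOf_isGeneric G).isClosed_compl.preimage ((hy 1).sub ha)
    convert h1.inter (h2.inter h3) using 1
    ext p
    simp [Z]
  have heq : degenerateSet c = Prod.fst '' Z := by
    ext x
    constructor
    · rintro ⟨lam, u, b, h0, h, hu⟩
      have hya : ∀ g, y (x, ⟨lam, h0, h.le_one h0⟩) g = b + g.1 u := fun g => (h g).2
      have hab : a (x, ⟨lam, h0, h.le_one h0⟩) = b := by
        simp only [a, hya, Finset.sum_add_distrib, hess.sum_apply_eq_zero, add_zero,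
          Finset.sum_const, Finset.card_univ, ← Nat.cast_smul_eq_nsmul ℝ, smul_smul]
        rw [inv_mul_cancel₀ (Nat.cast_ne_zero.2 Fintype.card_ne_zero), one_smul]
      have hub : y (x, ⟨lam, h0, h.le_one h0⟩) 1 - a (x, ⟨lam, h0, h.le_one h0⟩) = u := by
        rw [hya, hab]
        exact add_sub_cancel_left b u
      refine ⟨(x, ⟨lam, h0, h.le_one h0⟩), ⟨fun g => (h g).1, fun g => ?_, ?_⟩, rfl⟩
      · rw [hub, hya, hab]
      · rw [hub]
        exact hu
    · rintro ⟨⟨_, lam⟩, ⟨h1, h2, h3⟩, rfl⟩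
      exact ⟨lam.1, _, _, lam.2.1, fun g => ⟨h1 g, h2 g⟩, h3⟩
  rw [heq]
  exact isClosedMap_fst_of_compactSpace _ hZ

open scoped Classical in
theorem sum_fiber_eq_add_sum_compl {M : Type*} [AddCommMonoid M] [Fintype G] {c : Fin N → G}
    {i : G → Fin N} (hi : ∀ g, c (i g) = g) (F : Fin N → M) (g : G) :
    ∑ j with c j = g, F j =
      F (i g) + ∑ k : {j // j ∉ Set.range i} with c k.1 = g, F k.1 := by
  have hinj : Function.Injective i := Function.LeftInverse.injective hi
  rw [Finset.sum_filter, ← Fintype.sum_subtype_add_sum_subtype (· ∈ Set.range i),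
    Finset.sum_filter]
  congr 1
  let e : G ≃ {j // j ∈ Set.range i} := Equiv.ofInjective i hinj
  refine (Finset.sum_equiv (s := Finset.univ) e (f := fun h => if c (i h) = g then F (i h) else 0)
    (by simp) fun h _ => rfl).symm.trans ?_
  simp [hi]

open scoped Classical in
-- The representative x (i g) of each block can be solved for from the other points, the weight
-- ratios, u and a. These parameters number (N - r)(d + 1) + 2d = N d, and non-generic u is a null
-- condition on them.
theorem volume_degenerate_eq_zero [Fintype G] (hN : N + 2 * d = Fintype.card G * (d + 1))
    {c : Fin N → G} {i : G → Fin N} (hi : ∀ g, c (i g) = g) :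
    volume {x : Fin N → Euc d | ∃ (lam : Fin N → ℝ) (u a : Euc d), (∀ g, lam (i g) ≠ 0) ∧
      IsOrbitCombination x c lam u a ∧ ¬ IsGeneric G u} = 0 := by
  have hinj : Function.Injective i := Function.LeftInverse.injective hi
  have hJ : Fintype.card {j // j ∉ Set.range i} + Fintype.card G = N := by
    have h1 := Fintype.card_subtype_compl (fun j => j ∈ Set.range i)
    have h2 : Fintype.card {j // j ∈ Set.range i} = Fintype.card G :=
      (Fintype.card_congr (Equiv.ofInjective i hinj)).symm
    have h3 := Fintype.card_le_of_injective i hinj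
    rw [h2, Fintype.card_fin] at h1
    rw [Fintype.card_fin] at h3
    show Fintype.card {j // ¬ j ∈ Set.range i} + _ = _
    omega
  have hfin : Module.finrank ℝ (Fin N → Euc d) = Module.finrank ℝ (({j // j ∉ Set.range i} → ℝ) × ({j // j ∉ Set.range i} → Euc d) × Euc d × Euc d) := by
    simp only [Module.finrank_prod, finrank_euclideanSpace, Fintype.card_fin,
      Module.finrank_self, Module.finrank_pi_fintype, Finset.sum_const, Finset.card_univ,
      smul_eq_mul, mul_one]
    have h1 : N * d = Fintype.card {j // j ∉ Set.range i} * d + Fintype.card G * d := by rw [← add_mul, hJ]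
    rw [mul_add] at hN
    omega
  let e : (Fin N → Euc d) ≃L[ℝ] ({j // j ∉ Set.range i} → ℝ) × ({j // j ∉ Set.range i} → Euc d) × Euc d × Euc d := ContinuousLinearEquiv.ofFinrankEq hfin
  -- With ratios μₖ = lam k / lam (i g), block weight 1 gives 1 / lam (i g) = 1 + ∑ μₖ, the
  -- coefficient of a + g u.
  let Φ : ({j // j ∉ Set.range i} → ℝ) × ({j // j ∉ Set.range i} → Euc d) × Euc d × Euc d → Fin N → Euc d := fun p j =>
    if h : j ∉ Set.range i then p.2.1 ⟨j, h⟩ else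
      (1 + ∑ k : {j // j ∉ Set.range i} with c k.1 = c j, p.1 k) • (p.2.2.2 + (c j).1 p.2.2.1) -
        ∑ k : {j // j ∉ Set.range i} with c k.1 = c j, p.1 k • p.2.1 k
  have hΦ : Differentiable ℝ Φ := by
    rw [differentiable_pi]
    intro j
    by_cases h : j ∉ Set.range i
    · simp only [Φ, dif_pos h]
      fun_prop
    · simp only [Φ, dif_neg h]
      have : Differentiable ℝ ((c j).1 : Euc d → Euc d) := (c j).1.differentiable
      fun_prop
  let π : (Fin N → Euc d) →ₗ[ℝ] Euc d := LinearMap.fst ℝ _ _ ∘ₗ LinearMap.snd ℝ _ _ ∘ₗ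
    LinearMap.snd ℝ _ _ ∘ₗ e.toLinearEquiv.toLinearMap
  have hπ : Function.Surjective π := fun u =>
    ⟨e.symm (0, 0, u, 0), by simp [π]⟩
  have hnull : volume {p | ¬ IsGeneric G (π p)} = 0 :=
    ae_iff.1 ((ae_comp_linearMap_mem_iff π volume volume hπ
      (isOpen_setOf_isGeneric G).measurableSet).2 (ae_isGeneric G))
  have himage := addHaar_image_eq_zero_of_differentiableOn_of_addHaar_eq_zero volume
    (hΦ.comp e.differentiable).differentiableOn hnull
  refine measure_mono_null ?_ himage
  rintro x ⟨lam, u, a, hlam, h, hu⟩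
  refine ⟨e.symm (fun k => lam k / lam (i (c k)), fun k => x k, u, a), ?_, ?_⟩
  · simpa [π] using hu
  · rw [Function.comp_apply, e.apply_symm_apply]
    ext1 j
    by_cases hj : j ∉ Set.range i
    · simp only [Φ, dif_pos hj]
    · obtain ⟨g, rfl⟩ := not_not.1 hj
      simp only [Φ, dif_neg hj, hi]
      obtain ⟨h1, h2⟩ := h g
      rw [sum_fiber_eq_add_sum_compl hi] at h1 h2
      have h3 : ∑ k : {j // j ∉ Set.range i} with c k.1 = g, lam k / lam (i (c k)) =
          (lam (i g))⁻¹ * ∑ k : {j // j ∉ Set.range i} with c k.1 = g, lam k := by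
        rw [Finset.mul_sum]
        refine Finset.sum_congr rfl fun k hk => ?_
        rw [(Finset.mem_filter.1 hk).2, div_eq_inv_mul]
      have h4 : ∑ k : {j // j ∉ Set.range i} with c k.1 = g, (lam k / lam (i (c k))) • x k =
          (lam (i g))⁻¹ • ∑ k : {j // j ∉ Set.range i} with c k.1 = g, lam k • x k := by
        rw [Finset.smul_sum]
        refine Finset.sum_congr rfl fun k hk => ?_
        rw [(Finset.mem_filter.1 hk).2, div_eq_inv_mul, mul_smul]
      rw [h3, h4, eq_sub_of_add_eq' h1, eq_sub_of_add_eq' h2, mul_sub,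
        inv_mul_cancel₀ (hlam g), smul_sub, inv_smul_smul₀ (hlam g)]
      module

/-- Block weights sum to 1, so each block has an index of nonzero weight; there are countably many
choices of representatives. -/
theorem volume_degenerateSet [Fintype G] (hN : N + 2 * d = Fintype.card G * (d + 1))
    (c : Fin N → G) : volume (degenerateSet (d := d) c) = 0 := by
  classical
  have : Countable {i : G → Fin N // ∀ g, c (i g) = g} := Subtype.countable
  refine measure_mono_null ?_ (measure_iUnion_null fun i : {i : G → Fin N // ∀ g, c (i g) = g} =>
    volume_degenerate_eq_zero hN i.2)
  rintro x ⟨lam, u, a, h0, h, hu⟩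
  have : ∀ g, ∃ j, c j = g ∧ lam j ≠ 0 := by
    intro g
    obtain ⟨j, hj, hj0⟩ := Finset.exists_ne_zero_of_sum_ne_zero
      ((h g).1.trans_ne one_ne_zero)
    exact ⟨j, (Finset.mem_filter.1 hj).2, hj0⟩
  choose i hi hi0 using this
  exact Set.mem_iUnion.2 ⟨⟨i, hi⟩, lam, u, a, hi0, h, hu⟩

end Generic

/-! ### Distinct points, the partition and the conclusion. -/

theorem isOpen_setOf_injective {ι X : Type*} [Finite ι] [TopologicalSpace X] [T2Space X] :
    IsOpen {x : ι → X | Function.Injective x} := by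
  have : {x : ι → X | Function.Injective x} = ⋂ (i) (j), {x | x i = x j → i = j} := by
    ext x
    simp [Function.Injective]
  rw [this]
  refine isOpen_iInter_of_finite fun i => isOpen_iInter_of_finite fun j => ?_
  by_cases h : i = j
  · simp [h]
  · simp only [h, imp_false]
    exact isOpen_ne_fun (continuous_apply i) (continuous_apply j)

theorem ae_injective (hd : 0 < d) (N : ℕ) :
    ∀ᵐ x : Fin N → Euc d, Function.Injective x := by
  have key : ∀ i j : Fin N, ∀ᵐ x : Fin N → Euc d, x i = x j → i = j := by
    intro i j
    by_cases h : i = j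
    · simp [h]
    let K : Submodule ℝ (Fin N → Euc d) :=
      LinearMap.eqLocus (LinearMap.proj (φ := fun _ : Fin N => Euc d) i) (LinearMap.proj j)
    have hK : K ≠ ⊤ := by
      have : Nonempty (Fin d) := ⟨⟨0, hd⟩⟩
      obtain ⟨v, hv⟩ := exists_ne (0 : Euc d)
      intro htop
      have hmem : Pi.single i v ∈ K := htop ▸ Submodule.mem_top
      have : (Pi.single i v : Fin N → Euc d) i = (Pi.single i v : Fin N → Euc d) j := hmem
      rw [Pi.single_eq_same, Pi.single_eq_of_ne (Ne.symm h)] at this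
      exact hv this
    have := Measure.addHaar_submodule volume K hK
    simp only [h, imp_false]
    exact measure_mono_null (fun x hx => not_not.1 hx) this
  have : ∀ᵐ x : Fin N → Euc d, ∀ i j, x i = x j → i = j := by
    simp only [Filter.eventually_all]
    exact key
  filter_upwards [this] with x hx i j h using hx i j h

theorem canBePartitionedBy_orbitPolytope {G : Subgroup (Orth d)} [Fintype G] {N : ℕ}
    {x : Fin N → Euc d} (hx : Function.Injective x) {c : Fin N → G} {lam : Fin N → ℝ}
    {u a : Euc d} (h0 : ∀ i, 0 ≤ lam i) (h : IsOrbitCombination x c lam u a)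
    (hu : IsFreeOrbit G u) :
    CanBePartitionedBy (Set.range x) (Nat.card G) (orbitPolytope G u a) := by
  classical
  let e : G ≃ Fin (Nat.card G) := Finite.equivFin G
  refine ⟨fun k => x '' {i | c i = e.symm k}, ?_, ?_, fun k => a + (e.symm k).1 u, ?_, ?_, ?_⟩
  · intro k l hkl
    rw [Set.disjoint_image_iff hx, Set.disjoint_left]
    intro i hi hi'
    exact hkl (e.symm.injective (hi.symm.trans hi'))
  · rw [← Set.image_iUnion, ← Set.image_univ]
    congr 1
    exact Set.eq_univ_of_forall fun i => Set.mem_iUnion.2 ⟨e (c i), by simp⟩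
  · intro k l hkl
    have h1 : ((e.symm l).1⁻¹ * (e.symm k).1) u = u :=
      (LinearIsometryEquiv.symm_apply_eq (e.symm l).1).2 (add_left_cancel hkl)
    have h2 := hu.2 _ (G.mul_mem (G.inv_mem (e.symm l).2) (e.symm k).2) h1
    exact (e.symm.injective (Subtype.ext (inv_mul_eq_one.1 h2))).symm
  · intro k
    dsimp only
    rw [← (h (e.symm k)).2]
    exact (convex_convexHull ℝ _).sum_mem (fun i _ => h0 i) (h (e.symm k)).1 fun i hi =>
      subset_convexHull ℝ _ ⟨i, (Finset.mem_filter.1 hi).2, rfl⟩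
  · rw [extremePoints_orbitPolytope hu.1]
    ext y
    constructor
    · rintro ⟨k, rfl⟩
      exact ⟨_, (e.symm k).2, rfl⟩
    · rintro ⟨g, hg, rfl⟩
      exact ⟨e ⟨g, hg⟩, by simp⟩

end OrbitPartition

end

theorem corollary4p1 (d : ℕ) (hd : 2 ≤ d)
    (G : Subgroup (OrbitPartition.Orth d))
    (hG : OrbitPartition.IsFiniteReflectionGroup G)
    (hess : OrbitPartition.IsEssential G)
    (r : ℕ) (hr : r = Nat.card G) :
    OrbitPartition.HoldsForGenericSets d ((r - 2) * (d + 1) + 2) (fun S =>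
      ∃ u a : OrbitPartition.Euc d,
        OrbitPartition.IsFreeOrbit G u ∧
        affineSpan ℝ (OrbitPartition.orbitPolytope G u a) = ⊤ ∧
        OrbitPartition.isometryGroup (OrbitPartition.orbitPolytope G u a) =
          G.map (OrbitPartition.actionAbout a) ∧
        OrbitPartition.CanBePartitionedBy S r (OrbitPartition.orbitPolytope G u a)) := by
  have hd0 : 0 < d := by omega
  have := hG.1
  have : Fintype G := Fintype.ofFinite G
  subst hr
  -- Ensures that the natural-number subtraction |G| - 2 is not truncated.
  have hr2 : 2 ≤ Nat.card G := by
    obtain ⟨g, hg, hg1⟩ := hess.exists_ne_one hd0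
    have : Nontrivial G := ⟨⟨g, hg⟩, 1, fun h => hg1 (congrArg Subtype.val h)⟩
    exact Finite.one_lt_card
  obtain ⟨m, hm⟩ := Nat.exists_eq_add_of_le hr2
  generalize hNdef : (Nat.card G - 2) * (d + 1) + 2 = N
  have hN : N + 2 * d = Fintype.card G * (d + 1) := by
    rw [← hNdef, ← Nat.card_eq_fintype_card, hm, Nat.add_sub_cancel_left]
    ring
  let U : Set (Fin N → OrbitPartition.Euc d) :=
    {x | Function.Injective x} ∩ (⋃ c : Fin N → G, OrbitPartition.degenerateSet c)ᶜ
  have hU : ∀ᵐ x, x ∈ U :=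
    (OrbitPartition.ae_injective hd0 N).and <| measure_eq_zero_iff_ae_notMem.1
      (measure_iUnion_null fun c => OrbitPartition.volume_degenerateSet hN c)
  refine ⟨U, ?_, Measure.dense_of_ae hU, hU, ?_⟩
  · exact OrbitPartition.isOpen_setOf_injective.inter
      (isClosed_iUnion_of_finite fun c =>
        OrbitPartition.isClosed_degenerateSet hess c).isOpen_compl
  · rintro x ⟨hx, hgen⟩
    obtain ⟨c, lam, u, a, h0, h⟩ :=
      OrbitPartition.exists_isOrbitCombination hess (by omega) x
    have hu : OrbitPartition.IsGeneric G u := by_contra fun hu =>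
      hgen (Set.mem_iUnion.2 ⟨c, lam, u, a, h0, h, hu⟩)
    have hfree := hu.isFreeOrbit hess hd0
    exact ⟨hx, u, a, hfree, hu.affineSpan_orbitPolytope hG hess a,
      hu.isometryGroup_orbitPolytope hG hess hd0 a,
      OrbitPartition.canBePartitionedBy_orbitPolytope hx h0 h hfree⟩
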